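/- Let $n\ge 1$ and $t>0$. For $\psi\in L^2(\mathbb{R}^n)$ let $\hat\psi$ denote its Fourier transform, $\hat\psi(\xi)=(2\pi)^{-n/2}\int_{\mathbb{R}^n}\psi(x)e^{-ix\cdot\xi}\,dx$, extended unitarily to $L^2(\mathbb{R}^n)$. For $\alpha\in\mathbb{N}^n$ (where $0\in\mathbb{N}$), put $|\alpha|=\alpha_1+\dots+\alpha_n$ and let $\Phi_\alpha(x)=\prod_{j=1}^n h_{\alpha_j}(x_j)$ be the normalized Hermite function, where $h_k(s)=(2^k k!\sqrt{\pi})^{-1/2}(-1)^k e^{s^2/2}\frac{d^k}{ds^k}e^{-s^2}$. Let $(\psi,\Phi_\alpha)=\int_{\mathbb{R}^n}\psi(x)\Phi_\alpha(x)\,dx$. Then there is a constant $K_{n,t}$, depending only on $n$ and $t$, such that for every real $C$ and every $\psi\in L^2(\mathbb{R}^n)$ satisfying, for almost all $x,\xi\in\mathbb{R}^n$, $$|\psi(x)|\le C e^{-\frac12\tanh(2t)|x|^2},\qquad |\hat\psi(\xi)|\le C e^{-\frac12\tanh(2t)|\xi|^2},$$ one has, for every $\alpha\in\mathbb{N}^n$,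 $$|(\psi,\Phi_\alpha)|\le K_{n,t}\,C\prod_{j=1}^n(2\alpha_j+1)^{-\frac{1}{4n}}\;e^{-(2|\alpha|+n)\frac{t}{2n}}.$$ -/

import Mathlib

open MeasureTheory
open scoped FourierTransform

noncomputable section

/-- The unitary Fourier transform `ψ̂(ξ) = (2π)^{-n/2} ∫ ψ(x) e^{-i x·ξ} dx` on `L²(ℝⁿ)`, as a
function defined up to null sets. Mathlib's `𝓕` on `L²` is the Plancherel extension of
`ξ ↦ ∫ ψ(x) e^{-2πi x·ξ} dx`, so it has to be evaluated at `ξ / (2π)` and rescaled. -/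
def unitaryFourier {n : ℕ} (ψ : Lp ℂ 2 (volume : Measure (EuclideanSpace ℝ (Fin n)))) :
    EuclideanSpace ℝ (Fin n) → ℂ :=
  fun ξ => (((2 * Real.pi) ^ (-(n : ℝ) / 2) : ℝ) : ℂ) *
    (𝓕 ψ : Lp ℂ 2 (volume : Measure (EuclideanSpace ℝ (Fin n)))) ((2 * Real.pi)⁻¹ • ξ)

/-- The `L²`-normalized one-dimensional Hermite function
`h_k(x) = (2^k k! √π)^{-1/2} H_k(x) e^{-x²/2}`. Here `H_k` is the physicists' Hermite polynomial,
`H_k(x) = 2^{k/2} He_k(√2 x)`, and Mathlib's `Polynomial.hermite k` is the probabilists' `He_k`. -/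
def hermiteFun (k : ℕ) (x : ℝ) : ℝ :=
  (Real.sqrt (k.factorial * Real.sqrt Real.pi))⁻¹ *
    Polynomial.aeval (Real.sqrt 2 * x) (Polynomial.hermite k) * Real.exp (-x ^ 2 / 2)

/-- The normalized Hermite function `Φ_α(x) = ∏_j h_{α_j}(x_j)` on `ℝⁿ`. -/
def hermiteFunMulti {n : ℕ} (α : Fin n → ℕ) (x : EuclideanSpace ℝ (Fin n)) : ℝ :=
  ∏ j, hermiteFun (α j) (x j)

/-- The Fourier-Hermite coefficient `(ψ, Φ_α)`, the `L²` inner product (`Φ_α` is real valued). -/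
def hermiteCoeff {n : ℕ} (ψ : Lp ℂ 2 (volume : Measure (EuclideanSpace ℝ (Fin n))))
    (α : Fin n → ℕ) : ℂ :=
  ∫ x, ψ x * (hermiteFunMulti α x : ℂ)

end

/-!
Freeze all indices but the `j`-th. The power series `F(z) = ∑ₖ aₖ zᵏ / √k!` of the coefficients
`aₖ = (ψ, Φ_{α[j ↦ k]})` is a Bargmann transform of `ψ` in the variable `x_j`, and the Gaussian
bound on `ψ` integrates to `|F(x + iy)| ≤ M exp ((y² + q² x²) / 2)` with `q = e^{-2t}`. Since `Φ_α`
is an eigenfunction of the Fourier transform with eigenvalue `(-i)^|α|`, the bound on `ψ̂` gives the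
same estimate with `x` and `y` exchanged.

Phragmén-Lindelöf in the sectors around the diagonals, where these two estimates are weak, improves
the growth to `|F(r e^{iθ})| ≤ M exp (q r² / 2 - c r² cos² 2θ)`. Cauchy's formula on the circle
`q r² = k + 1/2`, where the angular integral of the Gaussian in `cos 2θ` gains a factor `1/r`,
bounds `aₖ` by a multiple of `(2k + 1)^{-1/4} e^{-(2k + 1) t / 2}`. Taking the geometric mean of the
bounds obtained for the `n` indices of `α` finishes the proof.
-/

open Real

section PhragmenLindelof

theorem norm_cexp_sq (ζ : ℂ) : ‖Complex.exp ζ‖ ^ 2 = exp (2 * ζ.re) := by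
  rw [Complex.norm_exp, ← exp_nat_mul, Nat.cast_two]

theorem re_cexp_sq (ζ : ℂ) : (Complex.exp ζ ^ 2).re = exp (2 * ζ.re) * cos (2 * ζ.im) := by
  rw [← Complex.exp_nat_mul, Complex.exp_re]
  simp

theorem im_cexp_sq (ζ : ℂ) : (Complex.exp ζ ^ 2).im = exp (2 * ζ.re) * sin (2 * ζ.im) := by
  rw [← Complex.exp_nat_mul, Complex.exp_im]
  simp

theorem norm_comp_cexp_le_of_im_mem_Icc {G : ℂ → ℂ} (hG : Differentiable ℂ G) {a b A B M : ℝ}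
    (hab : b - a < π / 2) (hgrowth : ∀ z, ‖G z‖ ≤ A * exp (B * ‖z‖ ^ 2))
    (ha : ∀ ζ : ℂ, ζ.im = a → ‖G (Complex.exp ζ)‖ ≤ M)
    (hb : ∀ ζ : ℂ, ζ.im = b → ‖G (Complex.exp ζ)‖ ≤ M) {ζ : ℂ} (hζ : ζ.im ∈ Set.Icc a b) :
    ‖G (Complex.exp ζ)‖ ≤ M := by
  rcases hζ.1.eq_or_lt with h | h
  · exact ha ζ h.symm
  have hlt : 0 < b - a := sub_pos.2 (h.trans_le hζ.2)
  have hA : 0 ≤ A := nonneg_of_mul_nonneg_left ((norm_nonneg _).trans (hgrowth 0)) (exp_pos _)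
  refine PhragmenLindelof.horizontal_strip (f := fun ζ => G (Complex.exp ζ))
    (hG.comp Complex.differentiable_exp).diffContOnCl ⟨2, ?_, |B|, ?_⟩ ha hb hζ.1 hζ.2
  · rw [lt_div_iff₀ hlt]
    linarith
  · refine Asymptotics.IsBigO.of_bound A (Filter.Eventually.of_forall fun z => ?_)
    rw [norm_of_nonneg (exp_pos _).le]
    refine (hgrowth _).trans ?_
    rw [norm_cexp_sq]
    gcongr
    · exact le_abs_self B
    · exact le_abs_self z.re

theorem exists_int_mem_Icc_of_abs_cos_le {φ x : ℝ} (hφ : 0 < φ) (hφ' : φ < π / 2)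
    (hx : |cos x| ≤ cos φ) : ∃ m : ℤ, x - m * π ∈ Set.Icc φ (π - φ) := by
  refine ⟨⌊x / π⌋, ?_⟩
  have h0 : 0 ≤ x - ⌊x / π⌋ * π := by
    have := (le_div_iff₀ pi_pos).1 (Int.floor_le (x / π))
    linarith
  have h1 : x - ⌊x / π⌋ * π < π := by
    have := (div_lt_iff₀ pi_pos).1 (Int.lt_floor_add_one (x / π))
    linarith
  have hcos : |cos (x - ⌊x / π⌋ * π)| ≤ cos φ := by
    rwa [cos_sub_int_mul_pi, abs_mul, abs_neg_one_zpow, one_mul]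
  obtain ⟨hl, hu⟩ := abs_le.1 hcos
  constructor
  · exact (strictAntiOn_cos.le_iff_ge ⟨h0, h1.le⟩ ⟨hφ.le, by linarith⟩).1 hu
  · rw [← cos_pi_sub] at hl
    exact (strictAntiOn_cos.le_iff_ge ⟨by linarith, by linarith⟩ ⟨h0, h1.le⟩).1 hl

variable {F : ℂ → ℂ} {M p φ : ℝ}

theorem norm_comp_cexp_le (hF : ∀ z, ‖F z‖ ≤ M * exp (p * (‖z‖ ^ 2 - cos φ * |(z ^ 2).re|)))
    (ζ : ℂ) : ‖F (Complex.exp ζ)‖ ≤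
      M * exp (p * exp (2 * ζ.re) * (1 - cos φ * |cos (2 * ζ.im)|)) := by
  refine (hF _).trans_eq ?_
  rw [norm_cexp_sq, re_cexp_sq, abs_mul, abs_of_pos (exp_pos _)]
  ring_nf

theorem norm_comp_cexp_mul_cexp (F : ℂ → ℂ) (b : ℝ) (ζ : ℂ) :
    ‖F (Complex.exp ζ) * Complex.exp (Complex.I * b * Complex.exp ζ ^ 2)‖ =
      ‖F (Complex.exp ζ)‖ * exp (-(b * exp (2 * ζ.re) * sin (2 * ζ.im))) := by
  rw [norm_mul, Complex.norm_exp, mul_assoc, Complex.I_mul_re, Complex.im_ofReal_mul, im_cexp_sq,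
    mul_assoc]

theorem norm_mul_cexp_mul_sq_le {A q : ℝ} {w z : ℂ} (hw : ‖w‖ ≤ A * exp (q * ‖z‖ ^ 2)) (b : ℝ) :
    ‖w * Complex.exp (Complex.I * b * z ^ 2)‖ ≤ A * exp ((q + |b|) * ‖z‖ ^ 2) := by
  rw [norm_mul, add_mul, exp_add, ← mul_assoc A]
  refine mul_le_mul hw ((Complex.norm_exp_le_exp_norm _).trans_eq ?_) (norm_nonneg _)
    ((norm_nonneg _).trans hw)
  simp only [norm_mul, Complex.norm_I, one_mul, Complex.norm_real, norm_pow, norm_eq_abs]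

-- On the edges of the sector the growth of `F` is exactly that of `exp (-i b z²)`.
theorem norm_comp_cexp_mul_cexp_le_of_edge
    (hF : ∀ z, ‖F z‖ ≤ M * exp (p * (‖z‖ ^ 2 - cos φ * |(z ^ 2).re|))) {b : ℝ} {ζ : ℂ}
    (hc : |cos (2 * ζ.im)| = cos φ) (hb : b * sin (2 * ζ.im) = p * sin φ ^ 2) :
    ‖F (Complex.exp ζ) * Complex.exp (Complex.I * b * Complex.exp ζ ^ 2)‖ ≤ M := by
  rw [norm_comp_cexp_mul_cexp]
  refine (mul_le_mul_of_nonneg_right (norm_comp_cexp_le hF ζ) (exp_pos _).le).trans_eq ?_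
  have hcancel : p * exp (2 * ζ.re) * (1 - cos φ * cos φ) +
      -(b * exp (2 * ζ.re) * sin (2 * ζ.im)) = 0 := by
    linear_combination -p * exp (2 * ζ.re) * sin_sq_add_cos_sq φ - exp (2 * ζ.re) * hb
  rw [mul_assoc, ← exp_add, hc, hcancel, exp_zero, mul_one]

theorem norm_comp_cexp_le_of_abs_cos_le (hd : Differentiable ℂ F) (hp : 0 ≤ p) (hφ : 0 < φ)
    (hφ' : φ < π / 2) (hF : ∀ z, ‖F z‖ ≤ M * exp (p * (‖z‖ ^ 2 - cos φ * |(z ^ 2).re|)))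
    {ζ : ℂ} (hζ : |cos (2 * ζ.im)| ≤ cos φ) :
    ‖F (Complex.exp ζ)‖ ≤ M * exp (p * sin φ * exp (2 * ζ.re) * |sin (2 * ζ.im)|) := by
  obtain ⟨m, hm⟩ := exists_int_mem_Icc_of_abs_cos_le hφ hφ' hζ
  have hM : 0 ≤ M := nonneg_of_mul_nonneg_left ((norm_nonneg _).trans (hF 0)) (exp_pos _)
  have hcos : 0 ≤ cos φ := (abs_nonneg _).trans hζ
  have hsin : 0 < sin φ := sin_pos_of_pos_of_lt_pi hφ (by linarith)
  set σ : ℝ := (-1) ^ m with hσ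
  have hσ_sq : σ * σ = 1 := by rw [← mul_zpow, neg_one_mul, neg_neg, one_zpow]
  have hedge (ζ : ℂ) (x : ℝ) (h : 2 * ζ.im = x + m * π) (hc : |cos x| = cos φ)
      (hs : sin x = sin φ) : ‖F (Complex.exp ζ) *
        Complex.exp (Complex.I * (σ * (p * sin φ) : ℝ) * Complex.exp ζ ^ 2)‖ ≤ M := by
    apply norm_comp_cexp_mul_cexp_le_of_edge hF
    · rw [h, cos_add_int_mul_pi, abs_mul, abs_neg_one_zpow, one_mul, hc]
    · rw [h, sin_add_int_mul_pi, ← hσ, hs]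
      linear_combination p * sin φ ^ 2 * hσ_sq
  have hbound : ‖F (Complex.exp ζ) *
      Complex.exp (Complex.I * (σ * (p * sin φ) : ℝ) * Complex.exp ζ ^ 2)‖ ≤ M := by
    refine norm_comp_cexp_le_of_im_mem_Icc
      (G := fun z => F z * Complex.exp (Complex.I * (σ * (p * sin φ) : ℝ) * z ^ 2))
      (a := (m * π + φ) / 2) (b := (m * π + (π - φ)) / 2) (hd.mul (by fun_prop)) (by linarith)
      (fun z => norm_mul_cexp_mul_sq_le (A := M) (q := p) ((hF z).trans ?_) _)
      (fun ζ h => hedge ζ φ (by linarith) (abs_of_nonneg hcos) rfl)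
      (fun ζ h => hedge ζ (π - φ) (by linarith) ?_ (sin_pi_sub φ))
      ⟨by linarith [hm.1], by linarith [hm.2]⟩
    · gcongr
      exact sub_le_self _ (by positivity)
    · rw [cos_pi_sub, abs_neg, abs_of_nonneg hcos]
  rw [norm_comp_cexp_mul_cexp, exp_neg, ← div_eq_mul_inv, div_le_iff₀ (exp_pos _)] at hbound
  refine hbound.trans ?_
  have hσ_le : σ * sin (2 * ζ.im) ≤ |sin (2 * ζ.im)| :=
    (le_abs_self _).trans_eq (by rw [abs_mul, hσ, abs_neg_one_zpow, one_mul])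
  gcongr M * exp ?_
  calc σ * (p * sin φ) * exp (2 * ζ.re) * sin (2 * ζ.im)
      = p * sin φ * exp (2 * ζ.re) * (σ * sin (2 * ζ.im)) := by ring
    _ ≤ p * sin φ * exp (2 * ζ.re) * |sin (2 * ζ.im)| := by gcongr

theorem abs_sin_le_one_sub_cos_sq (x : ℝ) : |sin x| ≤ 1 - cos x ^ 2 / 2 := by
  rw [cos_sq', abs_le]
  constructor <;> nlinarith [sq_nonneg (sin x - 1), sq_nonneg (sin x + 1)]

theorem one_sub_cos_mul_abs_cos_le {φ x : ℝ} (hφ : 0 ≤ cos φ) (hs : 0 ≤ sin φ)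
    (hx : cos φ ≤ |cos x|) :
    1 - cos φ * |cos x| ≤ sin φ * (1 - (1 - sin φ) / 2 * cos x ^ 2) := by
  have h1 : cos φ * cos φ ≤ cos φ * |cos x| := by gcongr
  have h2 : sin φ * (1 - sin φ) * cos x ^ 2 ≤ sin φ * (1 - sin φ) * 1 := by
    gcongr
    · exact mul_nonneg hs (sub_nonneg.2 (sin_le_one φ))
    · exact cos_sq_le_one x
  have h3 : 0 ≤ sin φ * (1 - sin φ) := mul_nonneg hs (sub_nonneg.2 (sin_le_one φ))
  linarith [sin_sq_add_cos_sq φ]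

theorem norm_circleMap_le_gaussian (hd : Differentiable ℂ F) (hp : 0 ≤ p) (hφ : 0 < φ)
    (hφ' : φ < π / 2) (hF : ∀ z, ‖F z‖ ≤ M * exp (p * (‖z‖ ^ 2 - cos φ * |(z ^ 2).re|)))
    {r : ℝ} (hr : 0 < r) (θ : ℝ) :
    ‖F (circleMap 0 r θ)‖ ≤ M * exp (p * sin φ * r ^ 2) *
      exp (-(p * sin φ * (1 - sin φ) / 2 * r ^ 2 * cos (2 * θ) ^ 2)) := by
  have hM : 0 ≤ M := nonneg_of_mul_nonneg_left ((norm_nonneg _).trans (hF 0)) (exp_pos _)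
  have hcos : 0 ≤ cos φ := (cos_pos_of_mem_Ioo ⟨by linarith, hφ'⟩).le
  have hsin : 0 ≤ sin φ := (sin_pos_of_pos_of_lt_pi hφ (by linarith)).le
  have hpolar : circleMap 0 r θ = Complex.exp (log r + θ * Complex.I) := by
    rw [circleMap_zero, Complex.exp_add, ← Complex.ofReal_exp, exp_log hr]
  have hr_sq : exp (2 * log r) = r ^ 2 := by rw [← exp_log hr, ← exp_nat_mul]; simp
  have hre : (log r + θ * Complex.I : ℂ).re = log r := by simp
  have him : (log r + θ * Complex.I : ℂ).im = θ := by simp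
  rw [hpolar, mul_assoc, ← exp_add]
  rcases le_or_gt |cos (2 * θ)| (cos φ) with hθ | hθ
  · refine (norm_comp_cexp_le_of_abs_cos_le hd hp hφ hφ' hF (by rwa [him])).trans ?_
    rw [hre, him, hr_sq]
    gcongr
    calc p * sin φ * r ^ 2 * |sin (2 * θ)|
        ≤ p * sin φ * r ^ 2 * (1 - (1 - sin φ) / 2 * cos (2 * θ) ^ 2) := by
          gcongr
          nlinarith [abs_sin_le_one_sub_cos_sq (2 * θ), mul_nonneg hsin (sq_nonneg (cos (2 * θ)))]
      _ = _ := by ring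
  · refine (norm_comp_cexp_le hF _).trans ?_
    rw [hre, him, hr_sq]
    gcongr
    calc p * r ^ 2 * (1 - cos φ * |cos (2 * θ)|)
        ≤ p * r ^ 2 * (sin φ * (1 - (1 - sin φ) / 2 * cos (2 * θ) ^ 2)) := by
          gcongr
          exact one_sub_cos_mul_abs_cos_le hcos hsin hθ.le
      _ = _ := by ring

end PhragmenLindelof

section EntireCoefficients

theorem integral_comp_two_mul_eq_of_periodic_pi {g : ℝ → ℝ} (hg : Continuous g)
    (hper : Function.Periodic g π) :
    ∫ θ in (0 : ℝ)..2 * π, g (2 * θ) = 2 * ∫ θ in (0 : ℝ)..π, g θ := by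
  have hfour : ∫ θ in (0 : ℝ)..4 * π, g θ = 4 * ∫ θ in (0 : ℝ)..π, g θ := by
    simpa using hper.intervalIntegral_add_zsmul_eq 4 0 fun a b => hg.intervalIntegrable a b
  rw [intervalIntegral.integral_comp_mul_left g two_ne_zero, mul_zero,
    show 2 * (2 * π) = 4 * π by ring, hfour, smul_eq_mul]
  ring

theorem integral_exp_neg_mul_sin_sq_le {c : ℝ} (hc : 0 < c) :
    ∫ θ in (-(π / 2))..(π / 2), exp (-(c * sin θ ^ 2)) ≤ π / 2 * √(π / c) := by
  have hpi : -(π / 2) ≤ π / 2 := by linarith [pi_pos]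
  have hd : 0 < c * (2 / π) ^ 2 := by positivity
  calc ∫ θ in (-(π / 2))..(π / 2), exp (-(c * sin θ ^ 2))
      ≤ ∫ θ in (-(π / 2))..(π / 2), exp (-(c * (2 / π) ^ 2) * θ ^ 2) := by
        refine intervalIntegral.integral_mono_on hpi
          (Continuous.intervalIntegrable (by fun_prop) _ _)
          (Continuous.intervalIntegrable (by fun_prop) _ _) fun θ hθ => ?_
        have hjordan : (2 / π * |θ|) ^ 2 ≤ |sin θ| ^ 2 := by
          gcongr
          exact mul_abs_le_abs_sin (abs_le.2 hθ)
        rw [mul_pow, sq_abs, sq_abs] at hjordan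
        rw [neg_mul, mul_assoc]
        gcongr
    _ ≤ ∫ θ : ℝ, exp (-(c * (2 / π) ^ 2) * θ ^ 2) := by
        rw [intervalIntegral.integral_of_le hpi]
        exact setIntegral_le_integral (integrable_exp_neg_mul_sq hd)
          (Filter.Eventually.of_forall fun θ => (exp_pos _).le)
    _ = π / 2 * √(π / c) := by
        rw [integral_gaussian, show π / (c * (2 / π) ^ 2) = (π / 2) ^ 2 * (π / c) by field_simp,
          sqrt_mul (by positivity), sqrt_sq (by positivity)]

theorem integral_exp_neg_mul_cos_two_mul_sq_le {c : ℝ} (hc : 0 < c) :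
    ∫ θ in (0 : ℝ)..2 * π, exp (-(c * cos (2 * θ) ^ 2)) ≤ π * √(π / c) := by
  have hper : Function.Periodic (fun θ => exp (-(c * cos θ ^ 2))) π := fun θ => by
    simp only [cos_add_pi, neg_sq]
  have hshift : ∫ θ in (0 : ℝ)..π, exp (-(c * cos θ ^ 2)) =
      ∫ θ in (-(π / 2))..(π / 2), exp (-(c * sin θ ^ 2)) := by
    have h := intervalIntegral.integral_comp_sub_left (a := 0) (b := π)
      (fun θ => exp (-(c * sin θ ^ 2))) (π / 2)
    simpa only [sin_pi_div_two_sub, sub_zero, show π / 2 - π = -(π / 2) by ring] using h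
  rw [integral_comp_two_mul_eq_of_periodic_pi (by fun_prop) hper, hshift]
  linarith [integral_exp_neg_mul_sin_sq_le hc]

theorem hasFPowerSeriesOnBall_of_hasSum {a : ℕ → ℂ} {F : ℂ → ℂ}
    (h : ∀ z, HasSum (fun k => a k * z ^ k) (F z)) :
    HasFPowerSeriesOnBall F (FormalMultilinearSeries.ofScalars ℂ a) 0 ⊤ where
  r_le := by
    refine ENNReal.le_of_forall_nnreal_lt fun r _ => ?_
    refine FormalMultilinearSeries.le_radius_of_tendsto _ (l := 0) ?_
    have hterm := (h r).summable.tendsto_atTop_zero.norm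
    simpa [FormalMultilinearSeries.ofScalars_norm] using hterm
  r_pos := by simp
  hasSum {y} _ := by
    simpa [FormalMultilinearSeries.ofScalars_apply_eq, mul_comm] using h y

theorem differentiable_of_hasSum {a : ℕ → ℂ} {F : ℂ → ℂ}
    (h : ∀ z, HasSum (fun k => a k * z ^ k) (F z)) : Differentiable ℂ F := fun _ =>
  ((hasFPowerSeriesOnBall_of_hasSum h).analyticAt_of_mem (by simp)).differentiableAt

theorem norm_coeff_mul_pow_le_circleIntegral {a : ℕ → ℂ} {F : ℂ → ℂ}
    (h : ∀ z, HasSum (fun k => a k * z ^ k) (F z)) (k : ℕ) {r : ℝ} (hr : 0 < r) :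
    ‖a k‖ * r ^ k ≤ (2 * π)⁻¹ * ∫ θ in (0 : ℝ)..2 * π, ‖F (circleMap 0 r θ)‖ := by
  have hseries := hasFPowerSeriesOnBall_of_hasSum h
  lift r to NNReal using hr.le
  have hcauchy := (differentiable_of_hasSum h).hasFPowerSeriesOnBall 0 (R := r)
    (by exact_mod_cast hr)
  have heq := hseries.hasFPowerSeriesAt.eq_formalMultilinearSeries hcauchy.hasFPowerSeriesAt
  have hnorm := norm_cauchyPowerSeries_le F 0 r k
  rwa [← heq, FormalMultilinearSeries.ofScalars_norm, abs_of_pos hr, inv_pow,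
    ← div_eq_mul_inv, le_div_iff₀ (by positivity)] at hnorm

theorem norm_coeff_mul_pow_succ_le {a : ℕ → ℂ} {F : ℂ → ℂ}
    (h : ∀ z, HasSum (fun k => a k * z ^ k) (F z)) {M p φ : ℝ} (hp : 0 < p) (hφ : 0 < φ)
    (hφ' : φ < π / 2) (hF : ∀ z, ‖F z‖ ≤ M * exp (p * (‖z‖ ^ 2 - cos φ * |(z ^ 2).re|)))
    (k : ℕ) {r : ℝ} (hr : 0 < r) :
    ‖a k‖ * r ^ (k + 1) ≤
      √(π / (p * sin φ * (1 - sin φ) / 2)) / 2 * (M * exp (p * sin φ * r ^ 2)) := by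
  have hd := differentiable_of_hasSum h
  have hM : 0 ≤ M := nonneg_of_mul_nonneg_left ((norm_nonneg _).trans (hF 0)) (exp_pos _)
  have hsin : 0 < sin φ := sin_pos_of_pos_of_lt_pi hφ (by linarith)
  have hsin' : 0 < 1 - sin φ := by
    have h := sin_lt_sin_of_lt_of_le_pi_div_two (by linarith) le_rfl hφ'
    rw [sin_pi_div_two] at h
    linarith
  set c := p * sin φ * (1 - sin φ) / 2
  have hc : 0 < c := by positivity
  have hangular : ∫ θ in (0 : ℝ)..2 * π, ‖F (circleMap 0 r θ)‖ ≤
      M * exp (p * sin φ * r ^ 2) * (π * √(π / c) / r) := by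
    calc ∫ θ in (0 : ℝ)..2 * π, ‖F (circleMap 0 r θ)‖
        ≤ ∫ θ in (0 : ℝ)..2 * π,
            M * exp (p * sin φ * r ^ 2) * exp (-(c * r ^ 2 * cos (2 * θ) ^ 2)) := by
          have hcont := hd.continuous
          exact intervalIntegral.integral_mono_on (by positivity)
            (Continuous.intervalIntegrable (by fun_prop) _ _)
            (Continuous.intervalIntegrable (by fun_prop) _ _)
            fun θ _ => norm_circleMap_le_gaussian hd hp.le hφ hφ' hF hr θ
      _ ≤ M * exp (p * sin φ * r ^ 2) * (π * √(π / (c * r ^ 2))) := by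
          rw [intervalIntegral.integral_const_mul]
          gcongr
          exact integral_exp_neg_mul_cos_two_mul_sq_le (by positivity)
      _ = _ := by rw [← div_div, sqrt_div' _ (sq_nonneg r), sqrt_sq hr.le, mul_div_assoc]
  calc ‖a k‖ * r ^ (k + 1) = ‖a k‖ * r ^ k * r := by rw [pow_succ, mul_assoc]
    _ ≤ (2 * π)⁻¹ * (M * exp (p * sin φ * r ^ 2) * (π * √(π / c) / r)) * r := by
        gcongr ?_ * r
        exact (norm_coeff_mul_pow_le_circleIntegral h k hr).trans (by gcongr)
    _ = _ := by field_simp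

theorem factorial_le_stirling (k : ℕ) :
    (k.factorial : ℝ) ≤ exp 1 * √(k + 1 / 2) * ((k + 1 / 2) / exp 1) ^ k := by
  cases k with
  | zero =>
    have hsqrt : (1 / 2 : ℝ) ≤ √(1 / 2) := by
      rw [le_sqrt (by norm_num) (by norm_num)]
      norm_num
    simp only [Nat.factorial_zero, Nat.cast_one, pow_zero, mul_one, Nat.cast_zero, zero_add]
    nlinarith [add_one_le_exp (1 : ℝ)]
  | succ m =>
    have h := Stirling.stirlingSeq'_antitone (Nat.zero_le m)
    simp only [Function.comp, Nat.succ_eq_add_one, zero_add, Stirling.stirlingSeq_one] at h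
    rw [Stirling.stirlingSeq, div_le_iff₀ (by positivity), ← mul_assoc] at h
    calc ((m + 1).factorial : ℝ)
        ≤ exp 1 / √2 * √(2 * (m + 1 : ℕ)) * ((m + 1 : ℕ) / exp 1) ^ (m + 1) := h
      _ = exp 1 * √(m + 1 : ℕ) * ((m + 1 : ℕ) / exp 1) ^ (m + 1) := by
          rw [sqrt_mul (by norm_num)]
          field_simp
      _ ≤ _ := by gcongr <;> linarith

theorem sqrt_factorial_mul_exp_le (k : ℕ) :
    √k.factorial * exp ((k + 1 / 2) / 2) ≤
      exp (3 / 4) * (k + 1 / 2 : ℝ) ^ (-(1 / 4) : ℝ) * √(k + 1 / 2) ^ (k + 1) := by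
  have h := factorial_le_stirling k
  have hy : (0 : ℝ) < k + 1 / 2 := by positivity
  have hexp : exp (k + 1 / 2) = exp 1 ^ k * exp (1 / 2) := by
    rw [← exp_nat_mul, ← exp_add, mul_one]
  have hexp' : exp (3 / 4) ^ 2 = exp 1 * exp (1 / 2) := by
    rw [← exp_nat_mul, ← exp_add]
    norm_num
  set y : ℝ := k + 1 / 2
  have hsqrt : √y = (y ^ (-(1 / 4) : ℝ)) ^ 2 * y := by
    rw [sqrt_eq_rpow, ← rpow_natCast, ← rpow_mul hy.le, ← rpow_add_one hy.ne']
    norm_num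
  refine (sq_le_sq₀ (by positivity) (by positivity)).1 ?_
  calc (√k.factorial * exp (y / 2)) ^ 2 = k.factorial * exp y := by
        rw [mul_pow, sq_sqrt (by positivity), ← exp_nat_mul, Nat.cast_two,
          mul_div_cancel₀ y two_ne_zero]
    _ ≤ exp 1 * √y * (y / exp 1) ^ k * exp y := by gcongr
    _ = exp (3 / 4) ^ 2 * (y ^ (-(1 / 4) : ℝ)) ^ 2 * (√y ^ 2) ^ (k + 1) := by
        rw [hexp, hexp', sq_sqrt hy.le, hsqrt, div_pow, pow_succ y]
        field_simp
    _ = _ := by ring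

-- The minimum over `r` of `√k! exp (γ r² / 2) / r ^ (k + 1)` is attained near `γ r² = k + 1 / 2`.
theorem le_of_forall_mul_pow_le {A x γ : ℝ} (hA : 0 ≤ A) (hγ : 0 < γ) {k : ℕ}
    (h : ∀ r > 0, x * r ^ (k + 1) ≤ A * (√k.factorial * exp (γ * r ^ 2 / 2))) :
    x ≤ A * exp (3 / 4) * (k + 1 / 2 : ℝ) ^ (-(1 / 4) : ℝ) * √γ ^ (k + 1) := by
  have hy : (0 : ℝ) < k + 1 / 2 := by positivity
  have hr := h (√(k + 1 / 2) / √γ) (by positivity)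
  rw [div_pow _ _ 2, sq_sqrt hy.le, sq_sqrt hγ.le, mul_div_cancel₀ _ hγ.ne', div_pow] at hr
  have hstirling := hr.trans (mul_le_mul_of_nonneg_left (sqrt_factorial_mul_exp_le k) hA)
  have hpos : 0 < √(k + 1 / 2 : ℝ) ^ (k + 1) / √γ ^ (k + 1) := by positivity
  refine le_of_mul_le_mul_right (hstirling.trans_eq ?_) hpos
  field_simp

theorem axial_le_of_axes {q : ℝ} (hq : 0 < q) {M : ℝ} {F : ℂ → ℂ}
    (him : ∀ z, ‖F z‖ ≤ M * exp ((z.im ^ 2 + q ^ 2 * z.re ^ 2) / 2))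
    (hre : ∀ z, ‖F z‖ ≤ M * exp ((z.re ^ 2 + q ^ 2 * z.im ^ 2) / 2)) (z : ℂ) :
    ‖F z‖ ≤
      M * exp ((1 + q ^ 2) / 4 * (‖z‖ ^ 2 - cos (2 * arctan q) * |(z ^ 2).re|)) := by
  have hnorm : ‖z‖ ^ 2 = z.re ^ 2 + z.im ^ 2 := by
    rw [← Complex.normSq_eq_norm_sq, Complex.normSq_apply]
    ring
  have hsq : (z ^ 2).re = z.re ^ 2 - z.im ^ 2 := by simp [sq]
  have hcos : (1 + q ^ 2) / 4 * cos (2 * arctan q) = (1 - q ^ 2) / 4 := by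
    rw [cos_two_mul, cos_sq_arctan]
    field_simp
    ring
  rw [mul_sub, ← mul_assoc, hcos, hnorm, hsq]
  rcases abs_cases (z.re ^ 2 - z.im ^ 2) with ⟨h, _⟩ | ⟨h, _⟩
  · refine (him z).trans_eq ?_
    rw [h]
    ring_nf
  · refine (hre z).trans_eq ?_
    rw [h]
    ring_nf

theorem exists_norm_coeff_le_of_axes {q : ℝ} (hq : 0 < q) (hq' : q < 1) :
    ∃ K : ℝ, 0 ≤ K ∧ ∀ (M : ℝ) (a : ℕ → ℂ) (F : ℂ → ℂ),
      (∀ z, HasSum (fun k => a k / (√k.factorial : ℂ) * z ^ k) (F z)) →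
      (∀ z, ‖F z‖ ≤ M * exp ((z.im ^ 2 + q ^ 2 * z.re ^ 2) / 2)) →
      (∀ z, ‖F z‖ ≤ M * exp ((z.re ^ 2 + q ^ 2 * z.im ^ 2) / 2)) →
      ∀ k : ℕ, ‖a k‖ ≤ K * M * (k + 1 / 2 : ℝ) ^ (-(1 / 4) : ℝ) * √q ^ (k + 1) := by
  set p := (1 + q ^ 2) / 4
  set φ := 2 * arctan q
  have hφ : 0 < φ := mul_pos two_pos (arctan_pos.2 hq)
  have hφ' : φ < π / 2 := by
    have h := arctan_strictMono hq'
    rw [arctan_one] at h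
    linarith
  have hsin : p * sin φ = q / 2 := by
    rw [sin_two_mul, sin_arctan, cos_arctan]
    field_simp
    rw [sq_sqrt (by positivity)]
    ring
  set D := √(π / (q / 2 * (1 - sin φ) / 2)) / 2
  refine ⟨D * exp (3 / 4), by positivity, fun M a F hsum him hre k => ?_⟩
  have hM : 0 ≤ M := nonneg_of_mul_nonneg_left ((norm_nonneg _).trans (him 0)) (exp_pos _)
  refine (le_of_forall_mul_pow_le (A := D * M) (γ := q) (by positivity) hq fun r hr => ?_).trans_eq
    (by ring)
  have hcoeff := norm_coeff_mul_pow_succ_le hsum (p := p) (by positivity) hφ hφ'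
    (axial_le_of_axes hq him hre) k hr
  rw [norm_div, Complex.norm_real, norm_of_nonneg (sqrt_nonneg _), div_mul_eq_mul_div,
    div_le_iff₀ (by positivity), hsin] at hcoeff
  calc ‖a k‖ * r ^ (k + 1) ≤ D * (M * exp (q / 2 * r ^ 2)) * √k.factorial := hcoeff
    _ = D * M * (√k.factorial * exp (q * r ^ 2 / 2)) := by
        rw [div_mul_eq_mul_div q]
        ring

end EntireCoefficients

section HermiteFunctions

open Polynomial in
theorem derivative_hermite_succ (k : ℕ) :
    derivative (hermite (k + 1)) = (k + 1 : ℤ[X]) * hermite k := by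
  induction k with
  | zero => simp
  | succ k ih =>
    have hderiv : derivative ((k + 1 : ℤ[X]) * hermite k) =
        (k + 1 : ℤ[X]) * derivative (hermite k) := by
      simp [derivative_mul]
    rw [hermite_succ (k + 1), derivative_sub, derivative_mul, derivative_X, ih, one_mul,
      hermite_succ k, hderiv]
    push_cast
    ring

theorem inv_sqrt_factorial_mul_eq (k : ℕ) :
    (√(k.factorial * √π))⁻¹ = √(k + 1) * (√((k + 1).factorial * √π))⁻¹ := by
  rw [Nat.factorial_succ, Nat.cast_mul, Nat.cast_succ, mul_assoc,
    sqrt_mul (x := (k + 1 : ℝ)) (by positivity), mul_inv, mul_inv_cancel_left₀ (by positivity)]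

theorem hasDerivAt_hermiteFun_derivative (k : ℕ) (x : ℝ) : HasDerivAt (hermiteFun k)
    (√2 * ((√(k.factorial * √π))⁻¹ *
      Polynomial.aeval (√2 * x) (Polynomial.derivative (Polynomial.hermite k)) *
        exp (-x ^ 2 / 2)) - x * hermiteFun k x) x := by
  have hpoly := ((Polynomial.hermite k).hasDerivAt_aeval (√2 * x)).comp x
    ((hasDerivAt_id x).const_mul √2)
  have hgauss := ((hasDerivAt_id x).pow 2).neg.div_const 2 |>.exp
  refine ((hpoly.const_mul _).mul hgauss).congr_deriv ?_
  simp only [hermiteFun, Function.comp, id, Nat.cast_ofNat, Nat.add_one_sub_one, pow_one, mul_one,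
    Pi.pow_apply, Pi.neg_apply]
  ring

theorem hasDerivAt_hermiteFun (k : ℕ) (x : ℝ) : HasDerivAt (hermiteFun k)
    (x * hermiteFun k x - √2 * √(k + 1) * hermiteFun (k + 1) x) x := by
  refine (hasDerivAt_hermiteFun_derivative k x).congr_deriv (Eq.symm ?_)
  have hsqrt : √2 * √2 = 2 := mul_self_sqrt zero_le_two
  simp only [hermiteFun, Polynomial.hermite_succ, map_sub, map_mul, Polynomial.aeval_X,
    inv_sqrt_factorial_mul_eq k]
  linear_combination (-x * √(k + 1) * (√((k + 1).factorial * √π))⁻¹ *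
    (Polynomial.aeval (√2 * x)) (Polynomial.hermite k) * exp (-x ^ 2 / 2)) * hsqrt

theorem hasDerivAt_hermiteFun_succ (k : ℕ) (x : ℝ) : HasDerivAt (hermiteFun (k + 1))
    (√2 * √(k + 1) * hermiteFun k x - x * hermiteFun (k + 1) x) x := by
  refine (hasDerivAt_hermiteFun_derivative (k + 1) x).congr_deriv (Eq.symm ?_)
  have hsqrt : √(k + 1 : ℝ) * √(k + 1) = k + 1 := mul_self_sqrt (by positivity)
  rw [derivative_hermite_succ]
  simp only [hermiteFun, map_mul, map_add, map_natCast, map_one, inv_sqrt_factorial_mul_eq k]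
  linear_combination (√2 * (√((k + 1).factorial * √π))⁻¹ *
    (Polynomial.aeval (√2 * x)) (Polynomial.hermite k) * exp (-x ^ 2 / 2)) * hsqrt

theorem differentiable_hermiteFun (k : ℕ) : Differentiable ℝ (hermiteFun k) := fun x =>
  (hasDerivAt_hermiteFun k x).differentiableAt

@[fun_prop]
theorem continuous_hermiteFun (k : ℕ) : Continuous (hermiteFun k) :=
  (differentiable_hermiteFun k).continuous

theorem integrable_polynomial_mul_exp_neg_mul_sq (P : Polynomial ℝ) {b : ℝ} (hb : 0 < b) :
    Integrable fun x : ℝ => P.eval x * exp (-b * x ^ 2) := by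
  induction P using Polynomial.induction_on' with
  | add P Q hP hQ =>
    simp only [Polynomial.eval_add, add_mul]
    exact hP.add hQ
  | monomial m a =>
    have hm : (-1 : ℝ) < m := by linarith [m.cast_nonneg (α := ℝ)]
    simpa [Polynomial.eval_monomial, mul_assoc] using
      (integrable_rpow_mul_exp_neg_mul_sq hb hm).const_mul a

theorem exists_polynomial_hermiteFun (k : ℕ) : ∃ P : Polynomial ℝ, ∀ x,
    hermiteFun k x = P.eval x * exp (-(1 / 2) * x ^ 2) := by
  refine ⟨Polynomial.C (√(k.factorial * √π))⁻¹ * ((Polynomial.hermite k).map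
    (algebraMap ℤ ℝ)).comp (Polynomial.C √2 * Polynomial.X), fun x => ?_⟩
  rw [hermiteFun, show -x ^ 2 / 2 = -(1 / 2) * x ^ 2 by ring]
  simp [← Polynomial.eval_map_algebraMap]

theorem integrable_hermiteFun (k : ℕ) : Integrable (hermiteFun k) := by
  obtain ⟨P, hP⟩ := exists_polynomial_hermiteFun k
  simpa only [← hP] using integrable_polynomial_mul_exp_neg_mul_sq P one_half_pos

theorem integrable_mul_hermiteFun (k : ℕ) : Integrable fun x => x * hermiteFun k x := by
  obtain ⟨P, hP⟩ := exists_polynomial_hermiteFun k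
  refine (integrable_polynomial_mul_exp_neg_mul_sq (Polynomial.X * P) one_half_pos).congr
    (Filter.Eventually.of_forall fun x => ?_)
  simp only [hP, Polynomial.eval_mul, Polynomial.eval_X, mul_assoc]

theorem integrable_hermiteFun_mul_hermiteFun (k l : ℕ) :
    Integrable fun x => hermiteFun k x * hermiteFun l x := by
  obtain ⟨P, hP⟩ := exists_polynomial_hermiteFun k
  obtain ⟨Q, hQ⟩ := exists_polynomial_hermiteFun l
  refine (integrable_polynomial_mul_exp_neg_mul_sq (P * Q) one_pos).congr
    (Filter.Eventually.of_forall fun x => ?_)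
  simp only [hP, hQ, Polynomial.eval_mul]
  rw [show -1 * x ^ 2 = -(1 / 2) * x ^ 2 + -(1 / 2) * x ^ 2 by ring, exp_add]
  ring

theorem integrable_hermiteFun_sq (k : ℕ) : Integrable fun x => hermiteFun k x ^ 2 := by
  simpa only [sq] using integrable_hermiteFun_mul_hermiteFun k k

theorem hermiteFun_zero (x : ℝ) : hermiteFun 0 x = (√√π)⁻¹ * exp (-x ^ 2 / 2) := by
  simp [hermiteFun]

theorem integral_hermiteFun_sq (k : ℕ) : ∫ x, hermiteFun k x ^ 2 = 1 := by
  induction k with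
  | zero =>
    have hsq : ∀ x, hermiteFun 0 x ^ 2 = (√π)⁻¹ * exp (-1 * x ^ 2) := fun x => by
      rw [hermiteFun_zero, mul_pow, inv_pow, sq_sqrt (sqrt_nonneg π), ← exp_nat_mul]
      ring_nf
    simp only [hsq]
    rw [integral_const_mul, integral_gaussian, div_one]
    exact inv_mul_cancel₀ (by positivity)
  | succ k ih =>
    have hk := integrable_hermiteFun_sq k
    have hk' := integrable_hermiteFun_sq (k + 1)
    have hderiv (x : ℝ) : HasDerivAt (fun x => hermiteFun k x * hermiteFun (k + 1) x)
        (√2 * √(k + 1) * (hermiteFun k x ^ 2 - hermiteFun (k + 1) x ^ 2)) x :=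
      ((hasDerivAt_hermiteFun k x).mul (hasDerivAt_hermiteFun_succ k x)).congr_deriv (by ring)
    have hzero := integral_eq_zero_of_hasDerivAt_of_integrable hderiv
      ((hk.sub hk').const_mul _) (integrable_hermiteFun_mul_hermiteFun k (k + 1))
    rw [integral_const_mul, integral_sub hk hk', ih] at hzero
    have hne : √2 * √(k + 1 : ℝ) ≠ 0 := by positivity
    linarith [(mul_eq_zero.1 hzero).resolve_left hne]

end HermiteFunctions

section FourierHermite

theorem fourier_const_smul {V E : Type*} [NormedAddCommGroup V] [InnerProductSpace ℝ V]
    [FiniteDimensional ℝ V] [MeasurableSpace V] [BorelSpace V] [NormedAddCommGroup E]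
    [NormedSpace ℂ E] (a : ℂ) (f : V → E) : 𝓕 (a • f) = a • 𝓕 f :=
  VectorFourier.fourierIntegral_const_smul 𝐞 volume (innerₗ V) f a

theorem fourier_add_of_integrable {V E : Type*} [NormedAddCommGroup V] [InnerProductSpace ℝ V]
    [FiniteDimensional ℝ V] [MeasurableSpace V] [BorelSpace V] [NormedAddCommGroup E]
    [NormedSpace ℂ E] {f g : V → E} (hf : Integrable f) (hg : Integrable g) :
    𝓕 (f + g) = 𝓕 f + 𝓕 g :=
  VectorFourier.fourierIntegral_add (L := innerₗ V) continuous_fourierChar continuous_inner hf hg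

theorem fourier_mul_sub_deriv {f : ℝ → ℂ} (hf : Integrable f) (hxf : Integrable fun x => x • f x)
    (hdiff : Differentiable ℝ f) (hf' : Integrable (deriv f)) (w : ℝ) :
    𝓕 (fun x : ℝ => 2 * π * x * f x - (2 * π : ℂ)⁻¹ * deriv f x) w =
      Complex.I * (deriv (𝓕 f) w - w * 𝓕 f w) := by
  have hpi : (π : ℂ) ≠ 0 := by exact_mod_cast pi_ne_zero
  have hxf' : Integrable fun x : ℝ => (-2 * π * Complex.I * x) • f x := by
    simpa [mul_assoc] using hxf.const_mul (-2 * π * Complex.I)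
  have hsplit : (fun x : ℝ => 2 * π * x * f x - (2 * π : ℂ)⁻¹ * deriv f x) =
      Complex.I • (fun x : ℝ => (-2 * π * Complex.I * x) • f x) +
        (-(2 * (π : ℂ))⁻¹) • deriv f := by
    ext x
    simp only [Pi.add_apply, Pi.smul_apply, smul_eq_mul]
    linear_combination (2 * π * x * f x) * Complex.I_sq
  rw [hsplit, fourier_add_of_integrable (hxf'.smul _) (hf'.smul _), fourier_const_smul,
    fourier_const_smul, ← deriv_fourier hf hxf, fourier_deriv hf hdiff hf']
  simp only [Pi.add_apply, Pi.smul_apply, smul_eq_mul]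
  field_simp
  ring

theorem fourier_hermiteFun_zero (w : ℝ) : 𝓕 (fun x : ℝ => (hermiteFun 0 (2 * π * x) : ℂ)) w =
    ((√(2 * π))⁻¹ : ℝ) * (hermiteFun 0 w : ℂ) := by
  have hpi : (π : ℂ) ≠ 0 := by exact_mod_cast pi_ne_zero
  have hsqrt : (2 * π : ℂ) ^ (1 / 2 : ℂ) = (√(2 * π) : ℂ) := by
    rw [sqrt_eq_rpow, Complex.ofReal_cpow (by positivity)]
    norm_num
  have hgauss : (fun x : ℝ => (hermiteFun 0 (2 * π * x) : ℂ)) =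
      ((√√π)⁻¹ : ℂ) • fun x : ℝ => Complex.exp (-π * (2 * π) * x ^ 2) := by
    ext x
    rw [hermiteFun_zero, Pi.smul_apply, smul_eq_mul]
    push_cast
    ring_nf
  rw [hgauss, fourier_const_smul, fourier_gaussian_pi (b := 2 * π) (by simp [pi_pos]),
    Pi.smul_apply, smul_eq_mul, hsqrt, hermiteFun_zero,
    show -π / (2 * π) * w ^ 2 = (-w ^ 2 / 2 : ℂ) by field_simp]
  push_cast
  ring

theorem hasDerivAt_ofReal_hermiteFun_mul (c : ℝ) (k : ℕ) (x : ℝ) :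
    HasDerivAt (fun x : ℝ => (hermiteFun k (c * x) : ℂ))
      (c * (c * x * hermiteFun k (c * x) - √2 * √(k + 1) * hermiteFun (k + 1) (c * x))) x := by
  refine (((hasDerivAt_hermiteFun k (c * x)).comp x
    ((hasDerivAt_id' x).const_mul c)).ofReal_comp).congr_deriv ?_
  push_cast
  ring

theorem integrable_ofReal_hermiteFun_mul {c : ℝ} (hc : c ≠ 0) (k : ℕ) :
    Integrable fun x : ℝ => (hermiteFun k (c * x) : ℂ) :=
  ((integrable_hermiteFun k).comp_mul_left' hc).ofReal

theorem integrable_smul_ofReal_hermiteFun_mul {c : ℝ} (hc : c ≠ 0) (k : ℕ) :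
    Integrable fun x : ℝ => x • (hermiteFun k (c * x) : ℂ) := by
  refine ((((integrable_mul_hermiteFun k).comp_mul_left' hc).const_mul c⁻¹).ofReal
    (𝕜 := ℂ)).congr (Filter.Eventually.of_forall fun x => ?_)
  simp only [mul_assoc, inv_mul_cancel_left₀ hc]
  exact Complex.ofReal_mul _ _

theorem integrable_deriv_ofReal_hermiteFun_mul {c : ℝ} (hc : c ≠ 0) (k : ℕ) :
    Integrable (deriv fun x : ℝ => (hermiteFun k (c * x) : ℂ)) := by
  rw [funext fun x => (hasDerivAt_ofReal_hermiteFun_mul c k x).deriv]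
  simpa [mul_assoc] using (((integrable_smul_ofReal_hermiteFun_mul hc k).const_mul (c : ℂ)).sub
    ((integrable_ofReal_hermiteFun_mul hc (k + 1)).const_mul (√2 * √(k + 1) : ℂ))).const_mul (c : ℂ)

theorem fourier_hermiteFun (k : ℕ) (w : ℝ) : 𝓕 (fun x : ℝ => (hermiteFun k (2 * π * x) : ℂ)) w =
    ((√(2 * π))⁻¹ : ℝ) * (-Complex.I) ^ k * (hermiteFun k w : ℂ) := by
  induction k generalizing w with
  | zero => simpa using fourier_hermiteFun_zero w
  | succ k ih =>
    have hpi : (2 * π : ℝ) ≠ 0 := by positivity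
    have hpi' : (2 * π : ℂ) ≠ 0 := by exact_mod_cast hpi
    have hσ : (√2 * √(k + 1) : ℂ) ≠ 0 := by
      have : √2 * √(k + 1 : ℝ) ≠ 0 := by positivity
      exact_mod_cast this
    have hcreate : (fun x : ℝ => 2 * π * x * (hermiteFun k (2 * π * x) : ℂ) -
          (2 * π : ℂ)⁻¹ * deriv (fun x : ℝ => (hermiteFun k (2 * π * x) : ℂ)) x) =
        (√2 * √(k + 1) : ℂ) • fun x : ℝ => (hermiteFun (k + 1) (2 * π * x) : ℂ) := by
      ext x
      rw [(hasDerivAt_ofReal_hermiteFun_mul (2 * π) k x).deriv, Pi.smul_apply, smul_eq_mul]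
      push_cast
      rw [inv_mul_cancel_left₀ hpi']
      ring
    have hderiv : deriv (𝓕 fun x : ℝ => (hermiteFun k (2 * π * x) : ℂ)) w =
        ((√(2 * π))⁻¹ : ℝ) * (-Complex.I) ^ k *
          (w * hermiteFun k w - √2 * √(k + 1) * hermiteFun (k + 1) w) := by
      have h := hasDerivAt_ofReal_hermiteFun_mul 1 k w
      simp only [one_mul, Complex.ofReal_one] at h
      rw [funext ih]
      exact (h.const_mul _).deriv
    have hladder := fourier_mul_sub_deriv (integrable_ofReal_hermiteFun_mul hpi k)
      (integrable_smul_ofReal_hermiteFun_mul hpi k)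
      (fun x => (hasDerivAt_ofReal_hermiteFun_mul _ k x).differentiableAt)
      (integrable_deriv_ofReal_hermiteFun_mul hpi k) w
    rw [hcreate, fourier_const_smul, Pi.smul_apply, smul_eq_mul, hderiv, ih] at hladder
    refine mul_left_cancel₀ hσ (hladder.trans ?_)
    ring

end FourierHermite

section BargmannKernel

theorem iteratedDeriv_exp_mul_sub (y : ℂ) (k : ℕ) :
    iteratedDeriv k (fun z : ℂ => Complex.exp (y * z - z ^ 2 / 2)) = fun z =>
      Polynomial.aeval (y - z) (Polynomial.hermite k) * Complex.exp (y * z - z ^ 2 / 2) := by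
  induction k with
  | zero => simp
  | succ k ih =>
    ext z
    rw [iteratedDeriv_succ, ih]
    have hpoly := ((Polynomial.hermite k).hasDerivAt_aeval (y - z)).comp z
      ((hasDerivAt_id' z).const_sub y)
    have hexp := (((hasDerivAt_id' z).const_mul y).sub
      ((hasDerivAt_pow 2 z).div_const 2)).cexp
    refine (hpoly.mul hexp).deriv.trans ?_
    simp only [Function.comp, Pi.sub_apply, Polynomial.hermite_succ, map_sub, map_mul,
      Polynomial.aeval_X]
    push_cast
    ring

theorem hasSum_hermite (y z : ℂ) :
    HasSum (fun k : ℕ => Polynomial.aeval y (Polynomial.hermite k) / k.factorial * z ^ k)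
      (Complex.exp (y * z - z ^ 2 / 2)) := by
  have hentire : Differentiable ℂ fun z : ℂ => Complex.exp (y * z - z ^ 2 / 2) := by fun_prop
  refine (Complex.hasSum_taylorSeries_of_entire hentire 0 z).congr_fun fun k => ?_
  rw [iteratedDeriv_exp_mul_sub]
  simp only [sub_zero, mul_zero, ne_eq, OfNat.ofNat_ne_zero, not_false_eq_true, zero_pow, zero_div,
    Complex.exp_zero, mul_one, smul_eq_mul]
  ring

/-- The Bargmann kernel `π^(-1/4) exp (-(z² + s²) / 2 + √2 z s)`, which is the generating function
`∑ₖ h_k(s) z^k / √k!` of the normalized Hermite functions. -/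
noncomputable def bargmannKernel (z : ℂ) (s : ℝ) : ℂ :=
  ((√√π)⁻¹ : ℝ) * Complex.exp (-(z ^ 2 + s ^ 2) / 2 + (√2 : ℂ) * z * s)

@[fun_prop]
theorem continuous_bargmannKernel (z : ℂ) : Continuous (bargmannKernel z) := by
  unfold bargmannKernel
  fun_prop

theorem hasSum_bargmannKernel (z : ℂ) (s : ℝ) :
    HasSum (fun k : ℕ => z ^ k / (√k.factorial : ℂ) * (hermiteFun k s : ℂ))
      (bargmannKernel z s) := by
  have hkernel : bargmannKernel z s = ((√√π)⁻¹ : ℝ) * Complex.exp (-s ^ 2 / 2) *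
      Complex.exp (((√2 * s : ℝ) : ℂ) * z - z ^ 2 / 2) := by
    rw [bargmannKernel, mul_assoc _ (Complex.exp _), ← Complex.exp_add]
    push_cast
    ring_nf
  rw [hkernel]
  refine ((hasSum_hermite ((√2 * s : ℝ) : ℂ) z).mul_left _).congr_fun fun k => ?_
  have haeval : Polynomial.aeval ((√2 * s : ℝ) : ℂ) (Polynomial.hermite k) =
      ((Polynomial.aeval (√2 * s) (Polynomial.hermite k) : ℝ) : ℂ) :=
    Polynomial.aeval_algebraMap_apply ℂ (√2 * s) (Polynomial.hermite k)
  have hfactorial : (k.factorial : ℂ) = (√k.factorial : ℂ) * (√k.factorial : ℂ) := by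
    rw [← Complex.ofReal_mul, mul_self_sqrt (by positivity), Complex.ofReal_natCast]
  rw [hermiteFun, haeval, hfactorial, sqrt_mul (by positivity)]
  push_cast
  ring

theorem norm_bargmannKernel (z : ℂ) (s : ℝ) : ‖bargmannKernel z s‖ =
    (√√π)⁻¹ * exp (-(z.re ^ 2 - z.im ^ 2 + s ^ 2) / 2 + √2 * z.re * s) := by
  have hre : (-(z ^ 2 + (s : ℂ) ^ 2) / 2 + (√2 : ℂ) * z * s).re =
      -(z.re ^ 2 - z.im ^ 2 + s ^ 2) / 2 + √2 * z.re * s := by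
    simp [sq]
  rw [bargmannKernel, norm_mul, Complex.norm_real, norm_of_nonneg (by positivity),
    Complex.norm_exp, hre]

/-- The `L¹` norm of `w` with respect to the Gaussian measure `exp (-b s²) ds`. -/
noncomputable def gaussianL1Norm (b : ℝ) (w : ℝ → ℂ) : ℝ :=
  ∫ s, exp (-b * s ^ 2) * ‖w s‖

variable {b : ℝ}

theorem gaussianL1Norm_nonneg (b : ℝ) (w : ℝ → ℂ) : 0 ≤ gaussianL1Norm b w :=
  integral_nonneg fun _ => by positivity

theorem exp_neg_mul_sq_mul_norm_bargmannKernel (hb : 0 < b) (z : ℂ) (s : ℝ) :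
    exp (-b * s ^ 2) * ‖bargmannKernel z s‖ =
      (√√π)⁻¹ * exp ((z.im ^ 2 + (1 - 2 * b) / (1 + 2 * b) * z.re ^ 2) / 2) *
        exp (-(b + 1 / 2) * (s - √2 * z.re / (1 + 2 * b)) ^ 2) := by
  have hsqrt : √2 ^ 2 = 2 := sq_sqrt zero_le_two
  rw [norm_bargmannKernel, mul_left_comm, ← exp_add, mul_assoc (√√π)⁻¹, ← exp_add]
  congr 2
  field_simp
  ring_nf
  rw [hsqrt]
  ring

theorem integrable_exp_mul_norm_bargmannKernel (hb : 0 < b) (z : ℂ) :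
    Integrable fun s => exp (-b * s ^ 2) * ‖bargmannKernel z s‖ := by
  simp only [exp_neg_mul_sq_mul_norm_bargmannKernel hb]
  exact ((integrable_exp_neg_mul_sq (by positivity)).comp_sub_right _).const_mul _

theorem gaussianL1Norm_bargmannKernel (hb : 0 < b) (z : ℂ) :
    gaussianL1Norm b (bargmannKernel z) = (√√π)⁻¹ * √(π / (b + 1 / 2)) *
      exp ((z.im ^ 2 + (1 - 2 * b) / (1 + 2 * b) * z.re ^ 2) / 2) := by
  simp only [gaussianL1Norm, exp_neg_mul_sq_mul_norm_bargmannKernel hb]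
  rw [integral_const_mul, integral_sub_right_eq_self (fun s => exp (-(b + 1 / 2) * s ^ 2)),
    integral_gaussian]
  ring

theorem exp_mul_norm_hermiteFun_le (b : ℝ) (k : ℕ) (s : ℝ) :
    exp (-b * s ^ 2) * ‖(hermiteFun k s : ℂ)‖ ≤ exp (-(2 * b) * s ^ 2) + hermiteFun k s ^ 2 := by
  have hexp : exp (-(2 * b) * s ^ 2) = exp (-b * s ^ 2) ^ 2 := by
    rw [← exp_nat_mul]
    push_cast
    ring_nf
  rw [Complex.norm_real, norm_eq_abs, hexp, ← sq_abs (hermiteFun k s)]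
  nlinarith [sq_nonneg (exp (-b * s ^ 2) - |hermiteFun k s|), sq_nonneg (exp (-b * s ^ 2)),
    sq_nonneg |hermiteFun k s|]

theorem integrable_exp_add_hermiteFun_sq (hb : 0 < b) (k : ℕ) :
    Integrable fun s : ℝ => exp (-(2 * b) * s ^ 2) + hermiteFun k s ^ 2 :=
  (integrable_exp_neg_mul_sq (by positivity)).add (integrable_hermiteFun_sq k)

theorem integrable_exp_mul_norm_hermiteFun (hb : 0 < b) (k : ℕ) :
    Integrable fun s => exp (-b * s ^ 2) * ‖(hermiteFun k s : ℂ)‖ := by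
  refine (integrable_exp_add_hermiteFun_sq hb k).mono' (by fun_prop)
    (Filter.Eventually.of_forall fun s => ?_)
  rw [norm_of_nonneg (by positivity)]
  exact exp_mul_norm_hermiteFun_le b k s

theorem gaussianL1Norm_hermiteFun_le (hb : 0 < b) (k : ℕ) :
    gaussianL1Norm b (fun s => (hermiteFun k s : ℂ)) ≤ √(π / (2 * b)) + 1 := by
  refine (integral_mono (integrable_exp_mul_norm_hermiteFun hb k)
    (integrable_exp_add_hermiteFun_sq hb k) (exp_mul_norm_hermiteFun_le b k)).trans_eq ?_
  rw [integral_add (integrable_exp_neg_mul_sq (by positivity)) (integrable_hermiteFun_sq k),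
    integral_gaussian, integral_hermiteFun_sq]

end BargmannKernel

section TensorPairing

variable {ι : Type*} [Fintype ι]

theorem integral_euclidean_prod {𝕜 : Type*} [RCLike 𝕜] (f : ι → ℝ → 𝕜) :
    ∫ x : EuclideanSpace ℝ ι, ∏ i, f i (x i) = ∏ i, ∫ s, f i s := by
  rw [← (PiLp.volume_preserving_toLp ι).integral_comp
    (MeasurableEquiv.toLp 2 _).measurableEmbedding]
  exact integral_fintype_prod_volume_eq_prod f

theorem integrable_euclidean_prod {𝕜 : Type*} [RCLike 𝕜] {f : ι → ℝ → 𝕜}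
    (hf : ∀ i, Integrable (f i)) : Integrable fun x : EuclideanSpace ℝ ι => ∏ i, f i (x i) := by
  rw [← (PiLp.volume_preserving_toLp ι).integrable_comp_emb
    (MeasurableEquiv.toLp 2 _).measurableEmbedding]
  exact Integrable.fintype_prod hf

theorem continuous_euclidean_prod {f : ι → ℝ → ℂ} (hf : ∀ i, Continuous (f i)) :
    Continuous fun x : EuclideanSpace ℝ ι => ∏ i, f i (x i) :=
  continuous_finsetProd _ fun i _ => (hf i).comp (by fun_prop)

theorem memLp_two_euclidean_prod {f : ι → ℝ → ℂ} (hf : ∀ i, Continuous (f i))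
    (hf2 : ∀ i, Integrable fun s => ‖f i s‖ ^ 2) :
    MemLp (fun x : EuclideanSpace ℝ ι => ∏ i, f i (x i)) 2 := by
  rw [memLp_two_iff_integrable_sq_norm (continuous_euclidean_prod hf).aestronglyMeasurable]
  simpa only [norm_prod, Finset.prod_pow] using integrable_euclidean_prod hf2

theorem fourier_euclidean_prod (f : ι → ℝ → ℂ) (x : EuclideanSpace ℝ ι) :
    𝓕 (fun v : EuclideanSpace ℝ ι => ∏ i, f i (v i)) x = ∏ i, 𝓕 (f i) (x i) := by
  simp only [fourier_real_eq_integral_exp_smul, smul_eq_mul]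
  rw [fourier_eq', ← integral_euclidean_prod fun i s =>
    Complex.exp (↑(-2 * π * s * x i) * Complex.I) * f i s]
  refine integral_congr_ae (Filter.Eventually.of_forall fun v => ?_)
  have hphase : -2 * π * inner ℝ v x = ∑ i, -2 * π * v i * x i := by
    rw [PiLp.inner_apply, Finset.mul_sum]
    simp only [RCLike.inner_apply, conj_trivial]
    exact Finset.sum_congr rfl fun i _ => by ring
  simp only [smul_eq_mul]
  rw [Finset.prod_mul_distrib, ← Complex.exp_sum, ← Finset.sum_mul, ← Complex.ofReal_sum, hphase]

theorem exp_neg_mul_norm_sq_eq_prod (b : ℝ) (x : EuclideanSpace ℝ ι) :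
    exp (-b * ‖x‖ ^ 2) = ∏ i, exp (-b * x i ^ 2) := by
  simp only [EuclideanSpace.norm_sq_eq, Finset.mul_sum, exp_sum, norm_eq_abs, sq_abs]

/-- The pairing `∫ g (⨂ᵢ wᵢ)` of a function on `ℝ^ι` with a tensor product of functions of one
variable. -/
noncomputable def tensorPairing (g : EuclideanSpace ℝ ι → ℂ) (w : ι → ℝ → ℂ) : ℂ :=
  ∫ x, g x * ∏ i, w i (x i)

theorem tensorPairing_const_mul (a : ℂ) (g : EuclideanSpace ℝ ι → ℂ) (w : ι → ℝ → ℂ) :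
    tensorPairing (fun x => a * g x) w = a * tensorPairing g w := by
  simp only [tensorPairing, mul_assoc]
  rw [integral_const_mul]

theorem tensorPairing_comp_inv_smul {a : ℝ} (ha : 0 < a) (g : EuclideanSpace ℝ ι → ℂ)
    (w : ι → ℝ → ℂ) : tensorPairing (fun x => g (a⁻¹ • x)) w =
      a ^ Fintype.card ι • tensorPairing g fun i s => w i (a * s) := by
  simpa only [tensorPairing, PiLp.smul_apply, smul_eq_mul, mul_inv_cancel_left₀ ha.ne', inv_pow,
    inv_inv, finrank_euclideanSpace, abs_of_pos (pow_pos ha _)] using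
    Measure.integral_comp_smul (volume : Measure (EuclideanSpace ℝ ι))
      (fun x => g x * ∏ i, w i (a * x i)) a⁻¹

variable {g : EuclideanSpace ℝ ι → ℂ} {C b : ℝ} {w : ι → ℝ → ℂ}

theorem nonneg_of_ae_norm_le_mul_exp (hgC : ∀ᵐ x, ‖g x‖ ≤ C * exp (-b * ‖x‖ ^ 2)) : 0 ≤ C := by
  obtain ⟨x, hx⟩ := hgC.exists
  exact nonneg_of_mul_nonneg_left ((norm_nonneg _).trans hx) (exp_pos _)

theorem ae_norm_mul_prod_le (hgC : ∀ᵐ x, ‖g x‖ ≤ C * exp (-b * ‖x‖ ^ 2)) (w : ι → ℝ → ℂ) :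
    ∀ᵐ x, ‖g x * ∏ i, w i (x i)‖ ≤ C * ∏ i, (exp (-b * x i ^ 2) * ‖w i (x i)‖) := by
  filter_upwards [hgC] with x hx
  rw [norm_mul, norm_prod, Finset.prod_mul_distrib, ← exp_neg_mul_norm_sq_eq_prod, ← mul_assoc]
  gcongr

theorem integrable_mul_prod (hg : AEStronglyMeasurable g)
    (hgC : ∀ᵐ x, ‖g x‖ ≤ C * exp (-b * ‖x‖ ^ 2)) (hw : ∀ i, Continuous (w i))
    (hwi : ∀ i, Integrable fun s => exp (-b * s ^ 2) * ‖w i s‖) :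
    Integrable fun x => g x * ∏ i, w i (x i) :=
  ((integrable_euclidean_prod hwi).const_mul C).mono'
    (hg.mul (continuous_euclidean_prod hw).aestronglyMeasurable) (ae_norm_mul_prod_le hgC w)

theorem integral_norm_mul_prod_le (hg : AEStronglyMeasurable g)
    (hgC : ∀ᵐ x, ‖g x‖ ≤ C * exp (-b * ‖x‖ ^ 2)) (hw : ∀ i, Continuous (w i))
    (hwi : ∀ i, Integrable fun s => exp (-b * s ^ 2) * ‖w i s‖) :
    ∫ x, ‖g x * ∏ i, w i (x i)‖ ≤ C * ∏ i, gaussianL1Norm b (w i) := by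
  refine (integral_mono_ae (integrable_mul_prod hg hgC hw hwi).norm
    ((integrable_euclidean_prod hwi).const_mul C) (ae_norm_mul_prod_le hgC w)).trans_eq ?_
  rw [integral_const_mul, integral_euclidean_prod fun i s => exp (-b * s ^ 2) * ‖w i s‖]
  rfl

theorem norm_tensorPairing_le (hg : AEStronglyMeasurable g)
    (hgC : ∀ᵐ x, ‖g x‖ ≤ C * exp (-b * ‖x‖ ^ 2)) (hw : ∀ i, Continuous (w i))
    (hwi : ∀ i, Integrable fun s => exp (-b * s ^ 2) * ‖w i s‖) :
    ‖tensorPairing g w‖ ≤ C * ∏ i, gaussianL1Norm b (w i) :=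
  (norm_integral_le_integral_norm _).trans (integral_norm_mul_prod_le hg hgC hw hwi)

variable [DecidableEq ι]

theorem prod_apply_update {M X : Type*} [CommMonoid M] (F : ι → X → M) (f : ι → X) (j : ι) (v : X) :
    ∏ i, F i (Function.update f j v i) = F j v * ∏ i ∈ Finset.univ \ {j}, F i (f i) := by
  simp only [Function.apply_update F, Finset.prod_update_of_mem (Finset.mem_univ j)]

theorem hasSum_tensorPairing_update {κ : Type*} [Countable κ] (hg : AEStronglyMeasurable g)
    (hgC : ∀ᵐ x, ‖g x‖ ≤ C * exp (-b * ‖x‖ ^ 2)) (hw : ∀ i, Continuous (w i))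
    (hwi : ∀ i, Integrable fun s => exp (-b * s ^ 2) * ‖w i s‖) (j : ι) {u : κ → ℝ → ℂ}
    (hu : ∀ k, Continuous (u k)) (hui : ∀ k, Integrable fun s => exp (-b * s ^ 2) * ‖u k s‖)
    {L : ℝ} (huL : ∀ k, gaussianL1Norm b (u k) ≤ L) {c : κ → ℂ} (hc : Summable fun k => ‖c k‖)
    {v : ℝ → ℂ} (hv : ∀ s, HasSum (fun k => c k * u k s) (v s)) :
    HasSum (fun k => c k * tensorPairing g (Function.update w j (u k)))
      (tensorPairing g (Function.update w j v)) := by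
  have hC := nonneg_of_ae_norm_le_mul_exp hgC
  have hcont k : ∀ i, Continuous (Function.update w j (u k) i) :=
    (Function.forall_update_iff w fun _ f => Continuous f).2 ⟨hu k, fun i _ => hw i⟩
  have hint k : ∀ i, Integrable fun s => exp (-b * s ^ 2) * ‖Function.update w j (u k) i s‖ :=
    (Function.forall_update_iff w fun _ f => Integrable fun s => exp (-b * s ^ 2) * ‖f s‖).2
      ⟨hui k, fun i _ => hwi i⟩
  have hterm (x : EuclideanSpace ℝ ι) :
      HasSum (fun k => c k * (g x * ∏ i, Function.update w j (u k) i (x i)))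
        (g x * ∏ i, Function.update w j v i (x i)) := by
    simp only [prod_apply_update (fun i (f : ℝ → ℂ) => f (x i)), mul_left_comm (g x)]
    simpa only [mul_assoc] using
      (hv (x j)).mul_right (g x * ∏ i ∈ Finset.univ \ {j}, w i (x i))
  set P := ∏ i ∈ Finset.univ \ {j}, gaussianL1Norm b (w i)
  have hP : 0 ≤ P := Finset.prod_nonneg fun i _ => gaussianL1Norm_nonneg b (w i)
  have hbound k : ∫ x, ‖c k * (g x * ∏ i, Function.update w j (u k) i (x i))‖ ≤
      ‖c k‖ * (C * (L * P)) := by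
    simp only [norm_mul (c k)]
    rw [integral_const_mul]
    gcongr
    refine (integral_norm_mul_prod_le hg hgC (hcont k) (hint k)).trans ?_
    rw [prod_apply_update fun _ => gaussianL1Norm b]
    gcongr
    exact huL k
  have hsum := hasSum_integral_of_summable_integral_norm
    (fun k => (integrable_mul_prod hg hgC (hcont k) (hint k)).const_mul (c k))
    (Summable.of_nonneg_of_le (fun k => integral_nonneg fun x => norm_nonneg _) hbound
      (hc.mul_right _))
  simp only [(hterm _).tsum_eq, integral_const_mul] at hsum
  exact hsum

end TensorPairing

section FourierPairing

theorem continuous_integral_Lp_mul {X : Type*} [MeasurableSpace X] {μ : Measure X}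
    {p q : ENNReal} [Fact (1 ≤ p)] [Fact (1 ≤ q)] [p.HolderConjugate q] {U : X → ℂ}
    (hU : MemLp U q μ) : Continuous fun φ : Lp ℂ p μ => ∫ x, φ x * U x ∂μ := by
  let B := (ContinuousLinearMap.mul ℂ ℂ).lpPairing μ p q
  refine ((B.flip hU.toLp).continuous).congr fun φ => ?_
  rw [ContinuousLinearMap.flip_apply, ContinuousLinearMap.lpPairing_eq_integral]
  refine integral_congr_ae ?_
  filter_upwards [hU.coeFn_toLp] with x hx
  rw [hx, ContinuousLinearMap.mul_apply']

variable {V : Type*} [NormedAddCommGroup V] [InnerProductSpace ℝ V] [FiniteDimensional ℝ V]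
  [MeasurableSpace V] [BorelSpace V] {W : V → ℂ}

theorem integral_fourier_schwartz_mul (hW : Integrable W) (f : SchwartzMap V ℂ) :
    ∫ x, (𝓕 (f.toLp 2) : Lp ℂ 2 (volume : Measure V)) x * W x =
      ∫ x, (f.toLp 2 : Lp ℂ 2 (volume : Measure V)) x * 𝓕 W x := by
  have hleft : ∫ x, (𝓕 (f.toLp 2) : Lp ℂ 2 (volume : Measure V)) x * W x =
      ∫ x, 𝓕 (f : V → ℂ) x * W x := by
    rw [SchwartzMap.toLp_fourier_eq]
    refine integral_congr_ae ?_
    filter_upwards [(𝓕 f).coeFn_toLp 2 volume] with x hx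
    rw [hx, SchwartzMap.fourier_coe]
  have hright : ∫ x, (f.toLp 2 : Lp ℂ 2 (volume : Measure V)) x * 𝓕 W x = ∫ x, f x * 𝓕 W x := by
    refine integral_congr_ae ?_
    filter_upwards [f.coeFn_toLp 2 volume] with x hx
    rw [hx]
  have hswap := VectorFourier.integral_fourierIntegral_smul_eq_flip (L := innerₗ V)
    continuous_fourierChar continuous_inner (f.integrable (μ := volume)) hW
  rw [flip_innerₗ] at hswap
  rw [hleft, hright]
  exact hswap

theorem integral_fourier_mul_of_memLp (hW : Integrable W) (hW2 : MemLp W 2)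
    (hFW2 : MemLp (𝓕 W) 2) (ψ : Lp ℂ 2 (volume : Measure V)) :
    ∫ x, (𝓕 ψ : Lp ℂ 2 (volume : Measure V)) x * W x = ∫ x, ψ x * 𝓕 W x := by
  have hdense : DenseRange (SchwartzMap.toLpCLM ℝ (E := V) ℂ 2 (volume : Measure V)) :=
    SchwartzMap.denseRange_toLpCLM ENNReal.ofNat_ne_top
  exact hdense.induction_on
    (p := fun ψ => ∫ x, (𝓕 ψ : Lp ℂ 2 (volume : Measure V)) x * W x = ∫ x, ψ x * 𝓕 W x) ψ
    (isClosed_eq ((continuous_integral_Lp_mul hW2).comp (Lp.fourierTransformₗᵢ V ℂ).continuous)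
      (continuous_integral_Lp_mul hFW2))
    (integral_fourier_schwartz_mul hW)

end FourierPairing

section FourierHermiteCoefficients

variable {n : ℕ}

theorem hermiteCoeff_eq_tensorPairing (ψ : Lp ℂ 2 (volume : Measure (EuclideanSpace ℝ (Fin n))))
    (α : Fin n → ℕ) :
    hermiteCoeff ψ α = tensorPairing ψ fun i s => (hermiteFun (α i) s : ℂ) := by
  simp only [hermiteCoeff, hermiteFunMulti, tensorPairing, Complex.ofReal_prod]

theorem stronglyMeasurable_unitaryFourier
    (ψ : Lp ℂ 2 (volume : Measure (EuclideanSpace ℝ (Fin n)))) :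
    StronglyMeasurable (unitaryFourier ψ) :=
  ((Lp.stronglyMeasurable _).comp_measurable (measurable_const_smul _)).const_mul _

theorem memLp_two_prod_hermiteFun {ι : Type*} [Fintype ι] {c : ℝ} (hc : c ≠ 0) (α : ι → ℕ) :
    MemLp (fun x : EuclideanSpace ℝ ι => ∏ i, (hermiteFun (α i) (c * x i) : ℂ)) 2 :=
  memLp_two_euclidean_prod (f := fun i s => (hermiteFun (α i) (c * s) : ℂ))
    (fun i => by fun_prop) fun i => by
      simpa only [Complex.norm_real, norm_eq_abs, sq_abs] using
        (integrable_hermiteFun_sq (α i)).comp_mul_left' hc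

theorem fourier_prod_hermiteFun {ι : Type*} [Fintype ι] (α : ι → ℕ) :
    𝓕 (fun x : EuclideanSpace ℝ ι => ∏ i, (hermiteFun (α i) (2 * π * x i) : ℂ)) =
      fun x => ((√(2 * π))⁻¹ : ℝ) ^ Fintype.card ι * (-Complex.I) ^ (∑ i, α i) *
        ∏ i, (hermiteFun (α i) (x i) : ℂ) := by
  ext x
  rw [fourier_euclidean_prod fun i s => (hermiteFun (α i) (2 * π * s) : ℂ)]
  simp only [fourier_hermiteFun, Finset.prod_mul_distrib, Finset.prod_pow_eq_pow_sum,
    Finset.prod_const, Finset.card_univ]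

theorem tensorPairing_fourier_hermiteFun {ι : Type*} [Fintype ι]
    (ψ : Lp ℂ 2 (volume : Measure (EuclideanSpace ℝ ι))) (α : ι → ℕ) :
    tensorPairing (𝓕 ψ : Lp ℂ 2 (volume : Measure (EuclideanSpace ℝ ι)))
        (fun i s => (hermiteFun (α i) (2 * π * s) : ℂ)) =
      ((√(2 * π))⁻¹ : ℝ) ^ Fintype.card ι * (-Complex.I) ^ (∑ i, α i) *
        tensorPairing ψ fun i s => (hermiteFun (α i) s : ℂ) := by
  have hint : Integrable fun x : EuclideanSpace ℝ ι =>
      ∏ i, (hermiteFun (α i) (2 * π * x i) : ℂ) :=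
    integrable_euclidean_prod fun i => integrable_ofReal_hermiteFun_mul two_pi_pos.ne' (α i)
  have hmem : MemLp (fun x : EuclideanSpace ℝ ι => ∏ i, (hermiteFun (α i) (x i) : ℂ)) 2 := by
    simpa only [one_mul] using memLp_two_prod_hermiteFun one_ne_zero α
  have hself := integral_fourier_mul_of_memLp hint (memLp_two_prod_hermiteFun two_pi_pos.ne' α)
    (by rw [fourier_prod_hermiteFun]; exact hmem.const_mul _) ψ
  rw [fourier_prod_hermiteFun] at hself
  simp only [mul_left_comm (ψ _)] at hself
  rwa [integral_const_mul] at hself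

theorem rpow_neg_half_mul_pow_mul_inv_sqrt_pow {a : ℝ} (ha : 0 < a) (n : ℕ) :
    a ^ (-(n : ℝ) / 2) * (a ^ n * (√a)⁻¹ ^ n) = 1 := by
  rw [inv_pow, sqrt_eq_rpow, ← rpow_natCast, ← rpow_natCast _ n, ← rpow_mul ha.le,
    ← rpow_neg ha.le, ← rpow_add ha, ← rpow_add ha]
  ring_nf
  exact rpow_zero a

theorem tensorPairing_unitaryFourier_hermiteFun
    (ψ : Lp ℂ 2 (volume : Measure (EuclideanSpace ℝ (Fin n)))) (α : Fin n → ℕ) :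
    tensorPairing (unitaryFourier ψ) (fun i s => (hermiteFun (α i) s : ℂ)) =
      (-Complex.I) ^ (∑ i, α i) * tensorPairing ψ fun i s => (hermiteFun (α i) s : ℂ) := by
  have hconst := congrArg ((↑) : ℝ → ℂ) (rpow_neg_half_mul_pow_mul_inv_sqrt_pow two_pi_pos n)
  rw [Complex.ofReal_mul, Complex.ofReal_mul, Complex.ofReal_pow _ n, Complex.ofReal_one] at hconst
  unfold unitaryFourier
  rw [tensorPairing_const_mul, tensorPairing_comp_inv_smul two_pi_pos,
    tensorPairing_fourier_hermiteFun, Fintype.card_fin, Complex.real_smul]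
  push_cast at hconst ⊢
  linear_combination ((-Complex.I) ^ (∑ i, α i) *
    tensorPairing ψ fun i s => (hermiteFun (α i) s : ℂ)) * hconst

end FourierHermiteCoefficients

section PartialBargmann

variable {ι : Type*} [Fintype ι] [DecidableEq ι]

/-- The Bargmann transform of `g` in the `j`-th variable, the other variables being integrated
against the Hermite functions of index `α i`. The value of `α j` is irrelevant. -/
noncomputable def partialBargmann (g : EuclideanSpace ℝ ι → ℂ) (α : ι → ℕ) (j : ι) (z : ℂ) : ℂ :=
  tensorPairing g (Function.update (fun i s => (hermiteFun (α i) s : ℂ)) j (bargmannKernel z))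

theorem summable_norm_pow_div_sqrt_factorial (z : ℂ) :
    Summable fun k : ℕ => ‖z ^ k / (√k.factorial : ℂ)‖ := by
  refine Summable.of_nonneg_of_le (fun k => norm_nonneg _) (fun k => ?_)
    ((summable_pow_div_factorial (2 * ‖z‖ ^ 2)).add
      (summable_geometric_of_lt_one one_half_pos.le one_half_lt_one))
  have hsq : ‖z ^ k / (√k.factorial : ℂ)‖ ^ 2 =
      (2 * ‖z‖ ^ 2) ^ k / k.factorial * (1 / 2) ^ k := by
    rw [norm_div, norm_pow, Complex.norm_of_nonneg (sqrt_nonneg _), div_pow,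
      sq_sqrt (Nat.cast_nonneg _), div_mul_eq_mul_div, ← mul_pow, pow_right_comm]
    ring_nf
  have hx : 0 ≤ (2 * ‖z‖ ^ 2) ^ k / k.factorial := by positivity
  have hy : (0 : ℝ) ≤ (1 / 2) ^ k := by positivity
  refine (abs_le_of_sq_le_sq' ?_ (add_nonneg hx hy)).2
  rw [hsq]
  nlinarith

variable {g : EuclideanSpace ℝ ι → ℂ} {C b : ℝ}

theorem hasSum_partialBargmann (hg : AEStronglyMeasurable g) (hb : 0 < b)
    (hgC : ∀ᵐ x, ‖g x‖ ≤ C * exp (-b * ‖x‖ ^ 2)) (α : ι → ℕ) (j : ι) (z : ℂ) :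
    HasSum (fun k : ℕ => tensorPairing g (fun i s => (hermiteFun (Function.update α j k i) s : ℂ)) /
      (√k.factorial : ℂ) * z ^ k) (partialBargmann g α j z) := by
  have hsum := hasSum_tensorPairing_update hg hgC (w := fun i s => (hermiteFun (α i) s : ℂ))
    (fun i => by fun_prop) (fun i => integrable_exp_mul_norm_hermiteFun hb (α i)) j
    (u := fun k s => (hermiteFun k s : ℂ)) (fun k => by fun_prop)
    (integrable_exp_mul_norm_hermiteFun hb) (gaussianL1Norm_hermiteFun_le hb)
    (summable_norm_pow_div_sqrt_factorial z) (hasSum_bargmannKernel z)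
  refine hsum.congr_fun fun k => ?_
  have hupdate : Function.update (fun i s => (hermiteFun (α i) s : ℂ)) j
      (fun s => (hermiteFun k s : ℂ)) = fun i s => (hermiteFun (Function.update α j k i) s : ℂ) :=
    funext fun i => (Function.apply_update (fun _ m (s : ℝ) => (hermiteFun m s : ℂ)) α j k i).symm
  rw [hupdate]
  ring

theorem norm_partialBargmann_le (hg : AEStronglyMeasurable g) (hb : 0 < b)
    (hgC : ∀ᵐ x, ‖g x‖ ≤ C * exp (-b * ‖x‖ ^ 2)) (α : ι → ℕ) (j : ι) (z : ℂ) :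
    ‖partialBargmann g α j z‖ ≤
      (√√π)⁻¹ * √(π / (b + 1 / 2)) * (√(π / (2 * b)) + 1) ^ (Fintype.card ι - 1) * C *
        exp ((z.im ^ 2 + (1 - 2 * b) / (1 + 2 * b) * z.re ^ 2) / 2) := by
  have hC := nonneg_of_ae_norm_le_mul_exp hgC
  have hcont : ∀ i, Continuous (Function.update (fun i s => (hermiteFun (α i) s : ℂ)) j
      (bargmannKernel z) i) :=
    (Function.forall_update_iff _ fun _ f => Continuous f).2
      ⟨continuous_bargmannKernel z, fun i _ => by fun_prop⟩
  have hint : ∀ i, Integrable fun s => exp (-b * s ^ 2) *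
      ‖Function.update (fun i s => (hermiteFun (α i) s : ℂ)) j (bargmannKernel z) i s‖ :=
    (Function.forall_update_iff _ fun _ (f : ℝ → ℂ) =>
      Integrable fun s => exp (-b * s ^ 2) * ‖f s‖).2
      ⟨integrable_exp_mul_norm_bargmannKernel hb z,
        fun i _ => integrable_exp_mul_norm_hermiteFun hb (α i)⟩
  have hrest : ∏ i ∈ Finset.univ \ {j}, gaussianL1Norm b (fun s => (hermiteFun (α i) s : ℂ)) ≤
      (√(π / (2 * b)) + 1) ^ (Fintype.card ι - 1) := by
    refine (Finset.prod_le_prod (fun i _ => gaussianL1Norm_nonneg b _) fun i _ =>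
      gaussianL1Norm_hermiteFun_le hb (α i)).trans_eq ?_
    rw [Finset.prod_const, Finset.card_univ_sdiff, Finset.card_singleton]
  refine (norm_tensorPairing_le hg hgC hcont hint).trans ?_
  rw [prod_apply_update fun _ => gaussianL1Norm b, gaussianL1Norm_bargmannKernel hb]
  refine (mul_le_mul_of_nonneg_left (mul_le_mul_of_nonneg_left hrest ?_) hC).trans_eq ?_
  · positivity
  · ring

end PartialBargmann

section CoefficientDecay

variable {n : ℕ} {ψ : Lp ℂ 2 (volume : Measure (EuclideanSpace ℝ (Fin n)))} {C b : ℝ}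

theorem partialBargmann_unitaryFourier (hb : 0 < b)
    (hψ : ∀ᵐ x, ‖ψ x‖ ≤ C * exp (-b * ‖x‖ ^ 2))
    (hψF : ∀ᵐ ξ, ‖unitaryFourier ψ ξ‖ ≤ C * exp (-b * ‖ξ‖ ^ 2)) (α : Fin n → ℕ) (j : Fin n)
    (z : ℂ) : partialBargmann (unitaryFourier ψ) α j (Complex.I * z) =
      (-Complex.I) ^ (∑ i ∈ Finset.univ \ {j}, α i) * partialBargmann ψ α j z := by
  refine (hasSum_partialBargmann (stronglyMeasurable_unitaryFourier ψ).aestronglyMeasurable hb hψF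
    α j (Complex.I * z)).unique (((hasSum_partialBargmann (Lp.aestronglyMeasurable ψ) hb hψ
    α j z).mul_left _).congr_fun fun k => ?_)
  rw [tensorPairing_unitaryFourier_hermiteFun, Finset.sum_update_of_mem (Finset.mem_univ j),
    pow_add, mul_pow]
  have hI : (-Complex.I) ^ k * Complex.I ^ k = 1 := by
    rw [← mul_pow, neg_mul, Complex.I_mul_I, neg_neg, one_pow]
  linear_combination ((-Complex.I) ^ (∑ i ∈ Finset.univ \ {j}, α i) * (tensorPairing ψ
    (fun i s => (hermiteFun (Function.update α j k i) s : ℂ)) / (√k.factorial : ℂ) * z ^ k)) * hI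

theorem norm_partialBargmann_le_of_fourier (hb : 0 < b)
    (hψ : ∀ᵐ x, ‖ψ x‖ ≤ C * exp (-b * ‖x‖ ^ 2))
    (hψF : ∀ᵐ ξ, ‖unitaryFourier ψ ξ‖ ≤ C * exp (-b * ‖ξ‖ ^ 2)) (α : Fin n → ℕ) (j : Fin n)
    (z : ℂ) : ‖partialBargmann ψ α j z‖ ≤
      (√√π)⁻¹ * √(π / (b + 1 / 2)) * (√(π / (2 * b)) + 1) ^ (n - 1) * C *
        exp ((z.re ^ 2 + (1 - 2 * b) / (1 + 2 * b) * z.im ^ 2) / 2) := by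
  simpa [partialBargmann_unitaryFourier hb hψ hψF] using norm_partialBargmann_le
    (stronglyMeasurable_unitaryFourier ψ).aestronglyMeasurable hb hψF α j (Complex.I * z)

theorem one_sub_tanh_div_one_add_tanh (s : ℝ) : (1 - tanh s) / (1 + tanh s) = exp (-s) ^ 2 := by
  have hsub : 1 - tanh s = exp (-s) / cosh s := by
    rw [tanh_eq_sinh_div_cosh, ← cosh_sub_sinh, sub_div, div_self (cosh_pos s).ne']
  have hadd : 1 + tanh s = exp s / cosh s := by
    rw [tanh_eq_sinh_div_cosh, ← cosh_add_sinh, add_div, div_self (cosh_pos s).ne']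
  rw [hsub, hadd, div_div_div_cancel_right₀ (cosh_pos s).ne', sq, exp_neg, div_eq_mul_inv]

theorem rpow_mul_sqrt_exp_pow_le {t : ℝ} (ht : 0 < t) (k : ℕ) :
    (k + 1 / 2 : ℝ) ^ (-(1 / 4) : ℝ) * √(exp (-(2 * t))) ^ (k + 1) ≤
      (1 / 2) ^ (-(1 / 4) : ℝ) *
        ((2 * (k : ℝ) + 1) ^ (-(1 / 4) : ℝ) * exp (-((2 * (k : ℝ) + 1) * t / 2))) := by
  rw [← mul_assoc, ← mul_rpow one_half_pos.le (by positivity), ← exp_half, ← exp_nat_mul]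
  gcongr ?_ * exp ?_
  · exact (congrArg (· ^ (-(1 / 4) : ℝ)) (by ring)).le
  · push_cast
    linarith

theorem exists_norm_hermiteCoeff_le (n : ℕ) {t : ℝ} (ht : 0 < t) :
    ∃ K : ℝ, 0 ≤ K ∧ ∀ (C : ℝ) (ψ : Lp ℂ 2 (volume : Measure (EuclideanSpace ℝ (Fin n)))),
      (∀ᵐ x, ‖ψ x‖ ≤ C * exp (-(tanh (2 * t) / 2) * ‖x‖ ^ 2)) →
      (∀ᵐ ξ, ‖unitaryFourier ψ ξ‖ ≤ C * exp (-(tanh (2 * t) / 2) * ‖ξ‖ ^ 2)) →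
      ∀ (α : Fin n → ℕ) (j : Fin n), ‖hermiteCoeff ψ α‖ ≤
        K * C * ((2 * (α j : ℝ) + 1) ^ (-(1 / 4) : ℝ) * exp (-((2 * (α j : ℝ) + 1) * t / 2))) := by
  obtain ⟨K, hK, hcoeff⟩ := exists_norm_coeff_le_of_axes (exp_pos (-(2 * t)))
    (exp_lt_one_iff.2 (by linarith))
  set b := tanh (2 * t) / 2 with hb_def
  have hb : 0 < b := by
    rw [hb_def, tanh_eq_sinh_div_cosh]
    exact half_pos (div_pos (sinh_pos_iff.2 (by positivity)) (cosh_pos _))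
  have hratio : (1 - 2 * b) / (1 + 2 * b) = exp (-(2 * t)) ^ 2 := by
    rw [hb_def, mul_div_cancel₀ _ two_ne_zero, one_sub_tanh_div_one_add_tanh]
  set B := (√√π)⁻¹ * √(π / (b + 1 / 2)) * (√(π / (2 * b)) + 1) ^ (n - 1)
  refine ⟨K * B * (1 / 2) ^ (-(1 / 4) : ℝ), by positivity, fun C ψ hψ hψF α j => ?_⟩
  have hC := nonneg_of_ae_norm_le_mul_exp hψ
  have hdecay := hcoeff (B * C) _ (partialBargmann ψ α j)
    (hasSum_partialBargmann (Lp.aestronglyMeasurable ψ) hb hψ α j)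
    (fun z => by
      simpa only [hratio, Fintype.card_fin] using
        norm_partialBargmann_le (Lp.aestronglyMeasurable ψ) hb hψ α j z)
    (fun z => by
      simpa only [hratio] using norm_partialBargmann_le_of_fourier hb hψ hψF α j z) (α j)
  rw [Function.update_eq_self, ← hermiteCoeff_eq_tensorPairing, mul_assoc] at hdecay
  refine hdecay.trans ((mul_le_mul_of_nonneg_left (rpow_mul_sqrt_exp_pow_le ht (α j))
    (by positivity)).trans_eq ?_)
  ring

theorem le_mul_prod_rpow_of_forall_le {ι : Type*} [Fintype ι] [Nonempty ι] {x a : ℝ} {y : ι → ℝ}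
    (hx : 0 ≤ x) (ha : 0 ≤ a) (hy : ∀ i, 0 ≤ y i) (h : ∀ i, x ≤ a * y i) :
    x ≤ a * ∏ i, y i ^ (1 / (Fintype.card ι : ℝ)) := by
  have hroot {c : ℝ} (hc : 0 ≤ c) : ∏ _i : ι, c ^ (1 / (Fintype.card ι : ℝ)) = c := by
    rw [Finset.prod_const, Finset.card_univ, one_div, rpow_inv_natCast_pow hc Fintype.card_ne_zero]
  calc x = ∏ _i : ι, x ^ (1 / (Fintype.card ι : ℝ)) := (hroot hx).symm
    _ ≤ ∏ i, (a * y i) ^ (1 / (Fintype.card ι : ℝ)) := by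
        gcongr with i
        exact h i
    _ = a * ∏ i, y i ^ (1 / (Fintype.card ι : ℝ)) := by
        simp only [mul_rpow ha (hy _), Finset.prod_mul_distrib, hroot ha]

theorem prod_rpow_mul_exp_rpow (n : ℕ) (t : ℝ) (α : Fin n → ℕ) :
    ∏ j, ((2 * (α j : ℝ) + 1) ^ (-(1 / 4) : ℝ) *
        exp (-((2 * (α j : ℝ) + 1) * t / 2))) ^ (1 / (n : ℝ)) =
      (∏ j, (2 * (α j : ℝ) + 1) ^ (-(1 / (4 * (n : ℝ))))) *
        exp (-((2 * ((∑ j, α j : ℕ) : ℝ) + n) * t / (2 * n))) := by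
  have hfactor (j : Fin n) : ((2 * (α j : ℝ) + 1) ^ (-(1 / 4) : ℝ) *
      exp (-((2 * (α j : ℝ) + 1) * t / 2))) ^ (1 / (n : ℝ)) =
      (2 * (α j : ℝ) + 1) ^ (-(1 / (4 * (n : ℝ)))) *
        exp ((2 * (α j : ℝ) + 1) * (-t / (2 * n))) := by
    rw [mul_rpow (by positivity) (exp_nonneg _), ← rpow_mul (by positivity), ← exp_mul]
    ring_nf
  have hsum : ∑ j, (2 * (α j : ℝ) + 1) = 2 * ((∑ j, α j : ℕ) : ℝ) + n := by
    simp [Finset.sum_add_distrib, Finset.mul_sum]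
  simp only [hfactor, Finset.prod_mul_distrib]
  rw [← exp_sum, ← Finset.sum_mul, hsum]
  ring_nf

end CoefficientDecay

theorem theorem4p7 (n : ℕ) (hn : 1 ≤ n) (t : ℝ) (ht : 0 < t) :
    ∃ K : ℝ, ∀ (C : ℝ) (ψ : Lp ℂ 2 (volume : Measure (EuclideanSpace ℝ (Fin n)))),
      (∀ᵐ x, ‖ψ x‖ ≤ C * Real.exp (-(Real.tanh (2 * t) / 2) * ‖x‖ ^ 2)) →
      (∀ᵐ ξ, ‖unitaryFourier ψ ξ‖ ≤ C * Real.exp (-(Real.tanh (2 * t) / 2) * ‖ξ‖ ^ 2)) →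
      ∀ α : Fin n → ℕ,
        ‖hermiteCoeff ψ α‖ ≤
          K * C * (∏ j, (2 * (α j : ℝ) + 1) ^ (-(1 / (4 * (n : ℝ))))) *
            Real.exp (-((2 * ((∑ j, α j : ℕ) : ℝ) + n) * t / (2 * n))) := by
  obtain ⟨K, hK, hdecay⟩ := exists_norm_hermiteCoeff_le n ht
  refine ⟨K, fun C ψ hψ hψF α => ?_⟩
  have hC := nonneg_of_ae_norm_le_mul_exp hψ
  have : Nonempty (Fin n) := ⟨⟨0, hn⟩⟩
  have hmean := le_mul_prod_rpow_of_forall_le (norm_nonneg _) (mul_nonneg hK hC)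
    (fun j => by positivity) (hdecay C ψ hψ hψF α)
  rwa [Fintype.card_fin, prod_rpow_mul_exp_rpow, ← mul_assoc] at hmean
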